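/- Let $G$ be a finite abelian group (written additively) and let $E\subseteq G$ be a set of generators of $G$. The abelian Cayley digraph of $G$ and $E$ has the elements of $G$ as vertices and a directed edge from $u$ to $u+g$ for every $u\in G$ and every $g\in E$, so that every vertex has out-degree $|E|$, called the degree of the digraph. Its diameter is the maximum, over all ordered pairs $(u,v)$ of vertices, of the least length of a directed path from $u$ to $v$. For positive integers $n$ and $d$, let $f(n,d)$ denote the largest order $|G|$ among all abelian Cayley digraphs of $G$ and $E$ with $|E|=n$ and diameter at most $d$. **Theorem 1.3.** Let $d\ge 0$ be an integer. If an abelian Cayley digraph has degree at most $4$ and diameter at most $d$, then it has at most $\frac{11(d+4)^4}{343}$ vertices. In particular, for every integer $d\geq 1$ the maximum $f(4,d)$ exists and $$f(4,d)\leq \frac{11(d+4)^4}{343}.$$ -/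

import Mathlib

namespace AbelianCayley

/-- The Cayley digraph of an additive group `G` and a set `E ⊆ G`: its vertices are the elements
of `G`, and there is an edge from `u` to `u + g` for every vertex `u` and every `g ∈ E`. -/
def cayleyDigraph {G : Type*} [AddCommGroup G] (E : Set G) : Digraph G where
  Adj u v := ∃ g ∈ E, v = u + g

/-- `HasWalk Γ k u v`: there is a directed walk with exactly `k` edges from `u` to `v`. -/
def HasWalk {V : Type*} (Γ : Digraph V) : ℕ → V → V → Prop
  | 0, u, v => u = v
  | k + 1, u, v => ∃ w, Γ.Adj u w ∧ HasWalk Γ k w v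

/-- The directed distance from `u` to `v`: the least length of a directed walk from `u` to `v`,
and `⊤` if there is no such walk. -/
noncomputable def ddist {V : Type*} (Γ : Digraph V) (u v : V) : ℕ∞ :=
  ⨅ (k : ℕ) (_ : HasWalk Γ k u v), (k : ℕ∞)

/-- The diameter of a digraph: the supremum of the directed distances over all ordered pairs of
vertices. It is `⊤` if some vertex cannot be reached from some other one. -/
noncomputable def diameter {V : Type*} (Γ : Digraph V) : ℕ∞ :=
  ⨆ (u : V) (v : V), ddist Γ u v

/-- The out-degree of a vertex (used for finite digraphs only). -/
noncomputable def outDegree {V : Type*} (Γ : Digraph V) (u : V) : ℕ :=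
  {v : V | Γ.Adj u v}.ncard

/-- Every vertex of the Cayley digraph of `G` and `E` has out-degree `|E|`. -/
theorem outDegree_cayleyDigraph {G : Type*} [AddCommGroup G] (E : Set G) (u : G) :
    outDegree (cayleyDigraph E) u = E.ncard := by
  have h : {v : G | (cayleyDigraph E).Adj u v} = (fun g => u + g) '' E := by
    ext v
    constructor
    · rintro ⟨g, hg, rfl⟩
      exact ⟨g, hg, rfl⟩
    · rintro ⟨g, hg, rfl⟩
      exact ⟨g, hg, rfl⟩
  unfold outDegree
  rw [h, Set.ncard_image_of_injective _ (add_right_injective u)]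

/-- The orders of all Cayley digraphs of finite abelian groups `G` and generating sets `E` of `G`
with `|E| = n` whose diameter is at most `d`. -/
def cayleyOrders (n d : ℕ) : Set ℕ :=
  {m | ∃ (G : Type) (_ : AddCommGroup G) (_ : Finite G) (E : Set G),
    AddSubgroup.closure E = ⊤ ∧ E.ncard = n ∧
      diameter (cayleyDigraph E) ≤ (d : ℕ∞) ∧ Nat.card G = m}

/-- The largest order `f(n, d)` of an abelian Cayley digraph given by `n` generators and of
diameter at most `d`. -/
noncomputable def f (n d : ℕ) : ℕ := sSup (cayleyOrders n d)

end AbelianCayley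

/-! Choosing for each element its least representation, by degree and then lexicographically,
identifies `G` with a downward closed set of lattice points in the simplex of size `d`. That alone
gives `(d + 4).choose 4`. To improve it, slice this set into fibres parallel to `e 3`. The fibre
over a base point `f` has at most `d + 1 - ∑ i, R.rep f i` points; call the shortfall its defect.
The first point after the fibre lies in the base again, and `next` permutes the base. Where `f` and
`next f` both have large first coordinate, the fibres over the points `f - i • e 0` are no longer
than that over `f`, so they have large defects (`sum_min_le_sum_defect`). Since `min a t + min b t ≤
min a b + t` and `next` preserves sums over the base, the total defect is at least `∑ (2 * min
(R.rep f 0) t - t)`. It remains to count points in a simplex whose first coordinate has weight three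
up to `t`, and to take `t` near `(d + 4) / 7`. -/

namespace AbelianCayley

/-- A choice of one nonnegative representation of degree at most `d` for every element of `G` in
terms of `e 0, …, e 3` that is closed under lowering coefficients. -/
structure DownwardReps {G : Type*} [AddCommGroup G] (e : Fin 4 → G) (d : ℕ) where
  rep : G → Fin 4 → ℕ
  sum_smul : ∀ g, ∑ i, rep g i • e i = g
  degree_le : ∀ g, ∑ i, rep g i ≤ d
  rep_of_le : ∀ g x, x ≤ rep g → rep (∑ i, x i • e i) = x

/-- The degree-lexicographic order is total and translation invariant, so minimal representations
are unique and lowering their coefficients keeps them minimal. -/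
theorem exists_downwardReps {G : Type*} [AddCommGroup G] (e : Fin 4 → G) (d : ℕ)
    (h : ∀ g : G, ∃ x : Fin 4 → ℕ, ∑ i, x i ≤ d ∧ ∑ i, x i • e i = g) :
    Nonempty (DownwardReps e d) := by
  classical
  let key : (Fin 4 → ℕ) → ℕ ×ₗ Lex (Fin 4 → ℕ) := fun x => toLex (∑ i, x i, toLex x)
  have key_inj : Function.Injective key := fun x y hxy =>
    toLex.injective (congrArg (fun p => (ofLex p).2) hxy)
  have key_add : ∀ x y, key (x + y) = key x + key y := by
    intro x y
    simp only [key, Pi.add_apply, Finset.sum_add_distrib]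
    rfl
  have ex : ∀ g : G, ∃ x : Fin 4 → ℕ, ∑ i, x i • e i = g ∧
      ∀ y : Fin 4 → ℕ, ∑ i, y i • e i = g → key x ≤ key y := by
    intro g
    obtain ⟨x0, -, hx0⟩ := h g
    obtain ⟨x, hx, hmin⟩ := (InvImage.wf key
      (wellFounded_lt (α := ℕ ×ₗ Lex (Fin 4 → ℕ)))).has_min {x | ∑ i, x i • e i = g} ⟨x0, hx0⟩
    exact ⟨x, hx, fun y hy => not_lt.mp (hmin y hy)⟩
  choose r hr hmin using ex
  refine ⟨⟨r, hr, fun g => ?_, fun g x hx => ?_⟩⟩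
  · obtain ⟨y, hy, hyg⟩ := h g
    refine le_trans ?_ hy
    have := hmin g y hyg
    rcases Prod.Lex.toLex_le_toLex.mp this with h1 | h1
    · exact h1.le
    · exact h1.1.le
  · obtain ⟨z, hz⟩ := exists_add_of_le hx
    set g' := ∑ i, x i • e i with hg'
    have h1 : ∑ i, (r g' + z) i • e i = g := by
      rw [← hr g, hz]
      simp only [Pi.add_apply, add_smul, Finset.sum_add_distrib, hr g']
      rw [hg']
    have h2 := hmin g _ h1
    -- A better representation of `g'` would improve that of `g` after adding `z`.
    rw [hz, key_add, key_add, add_le_add_iff_right] at h2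
    exact key_inj (le_antisymm (hmin g' x hg'.symm) h2)

/-! ### Fibres in the direction of `e 3` -/

namespace DownwardReps

variable {G : Type*} [AddCommGroup G] {e : Fin 4 → G} {d : ℕ} (R : DownwardReps e d)

theorem rep_injective : Function.Injective R.rep := fun g g' h => by
  rw [← R.sum_smul g, h, R.sum_smul]

theorem rep_sub {g : G} {j : Fin 4} {i : ℕ} (hi : i ≤ R.rep g j) :
    R.rep (g - i • e j) = R.rep g - Pi.single j i := by
  have hle : Pi.single j i ≤ R.rep g := by
    intro k
    rcases eq_or_ne k j with rfl | hk
    · simpa using hi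
    · simp [hk]
  have h := R.rep_of_le g (R.rep g - Pi.single j i) tsub_le_self
  convert h using 2
  have h2 : ∑ k, (R.rep g - Pi.single j i + Pi.single j i : Fin 4 → ℕ) k • e k = g := by
    rw [tsub_add_cancel_of_le hle, R.sum_smul]
  simp only [Pi.add_apply, add_smul, Finset.sum_add_distrib] at h2
  have h3 : ∑ k, (Pi.single j i : Fin 4 → ℕ) k • e k = i • e j := by
    rw [Finset.sum_eq_single j]
    · simp
    · intro k _ hk
      simp [hk]
    · simp
  rw [sub_eq_iff_eq_add, ← h3, h2]

theorem exists_break (g : G) : ∃ k, R.rep (g + k • e 3) ≠ R.rep g + Pi.single 3 k := by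
  refine ⟨d + 1, fun h => ?_⟩
  have h1 := R.degree_le (g + (d + 1) • e 3)
  rw [h] at h1
  simp only [Fin.sum_univ_four, Pi.add_apply, Pi.single_eq_same] at h1
  omega

open Classical in
/-- The length of the fibre above `g` in the direction of `e 3`: the number of consecutive
translates `g + k • e 3` represented by adding `k` to the last coefficient of `g`. -/
noncomputable def height (g : G) : ℕ := Nat.find (R.exists_break g)

theorem rep_add_of_lt {g : G} {k : ℕ} (hk : k < R.height g) :
    R.rep (g + k • e 3) = R.rep g + Pi.single 3 k := by
  classical
  exact not_not.mp (Nat.find_min (R.exists_break g) hk)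

theorem rep_add_height (g : G) :
    R.rep (g + R.height g • e 3) ≠ R.rep g + Pi.single 3 (R.height g) := by
  classical
  exact Nat.find_spec (R.exists_break g)

theorem height_pos (g : G) : 0 < R.height g := by
  rcases Nat.eq_zero_or_pos (R.height g) with h | h
  · have := R.rep_add_height g
    rw [h] at this
    simp at this
  · exact h

theorem degree_add_height_le (g : G) : ∑ i, R.rep g i + R.height g ≤ d + 1 := by
  have hp := R.height_pos g
  have h1 := R.degree_le (g + (R.height g - 1) • e 3)
  rw [R.rep_add_of_lt (by omega)] at h1
  simp only [Fin.sum_univ_four, Pi.add_apply, Pi.single_eq_same] at h1 ⊢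
  omega

/-- The first point after the fibre above `g`. -/
noncomputable def next (g : G) : G := g + R.height g • e 3

/-- If the last coefficient were positive, removing one `e 3` would land on the last point of the
fibre, and the fibre would not have ended. -/
theorem rep_next_last (g : G) : R.rep (R.next g) 3 = 0 := by
  by_contra h
  have hp := R.height_pos g
  have h1 := R.rep_sub (g := R.next g) (j := 3) (i := 1) (by omega)
  have h2 : R.next g - 1 • e 3 = g + (R.height g - 1) • e 3 := by
    obtain ⟨m, hm⟩ := Nat.exists_eq_succ_of_ne_zero hp.ne'
    rw [next, hm, Nat.succ_sub_one, Nat.succ_eq_add_one, add_smul]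
    abel
  rw [h2, R.rep_add_of_lt (by omega)] at h1
  apply R.rep_add_height g
  change R.rep (R.next g) = _
  ext k
  have h3 := congrFun h1 k
  simp only [Pi.add_apply, Pi.sub_apply] at h3 ⊢
  rcases eq_or_ne k 3 with rfl | hk
  · simp only [Pi.single_eq_same] at h3 ⊢
    omega
  · simp only [Pi.single_eq_of_ne hk] at h3 ⊢
    omega

/-- In a longer fibre over `f - i • e 0`, the point `next f - i • e 0` would have positive last
coefficient; but its representation is that of `next f` lowered, with last coefficient zero. -/
theorem height_sub_le {f : G} {i : ℕ}
    (h2 : i ≤ R.rep (R.next f) 0) : R.height (f - i • e 0) ≤ R.height f := by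
  by_contra hlt
  push Not at hlt
  have h3 := R.rep_add_of_lt hlt
  have h4 : f - i • e 0 + R.height f • e 3 = R.next f - i • e 0 := by
    rw [next]; abel
  rw [h4, R.rep_sub h2] at h3
  have h5 := congrFun h3 3
  have hp := R.height_pos f
  simp only [Pi.sub_apply, Pi.add_apply, Pi.single_eq_same, R.rep_next_last] at h5
  omega

/-! ### Counting the group by fibres -/

variable [Fintype G]

open Classical in
/-- The elements whose representation does not use `e 3`. -/
noncomputable def base : Finset G := Finset.univ.filter fun g => R.rep g 3 = 0

theorem mem_base {g : G} : g ∈ R.base ↔ R.rep g 3 = 0 := by simp [base]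

theorem next_injOn : Set.InjOn R.next R.base := by
  have key : ∀ f f' : G, f' ∈ R.base → R.next f = R.next f' → R.height f' ≤ R.height f →
      f = f' := by
    intro f f' hf' h hle
    obtain ⟨k, hk⟩ := Nat.exists_eq_add_of_le hle
    have h1 : f + k • e 3 = f' := by
      simp only [next, hk, add_smul] at h
      have : f + k • e 3 + R.height f' • e 3 = f' + R.height f' • e 3 := by
        rw [← h]; abel
      exact add_right_cancel this
    have hp := R.height_pos f'
    have h2 := R.rep_add_of_lt (g := f) (k := k) (by omega)
    rw [h1] at h2
    have h3 := congrFun h2 3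
    rw [R.mem_base.mp hf'] at h3
    simp only [Pi.add_apply, Pi.single_eq_same] at h3
    have : k = 0 := by omega
    simpa [this] using h1
  intro f hf f' hf' h
  rcases le_total (R.height f') (R.height f) with hle | hle
  · exact key f f' hf' h hle
  · exact (key f' f hf h.symm hle).symm

theorem sum_next {M : Type*} [AddCommMonoid M] (w : G → M) :
    ∑ f ∈ R.base, w (R.next f) = ∑ f ∈ R.base, w f := by
  classical
  have himg : R.base.image R.next = R.base :=
    Finset.eq_of_subset_of_card_le
      (Finset.image_subset_iff.mpr fun f _ => R.mem_base.mpr (R.rep_next_last f))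
      (Finset.card_image_of_injOn R.next_injOn).ge
  rw [← Finset.sum_image (f := w) R.next_injOn, himg]

theorem card_eq_sum_height : Fintype.card G = ∑ f ∈ R.base, R.height f := by
  classical
  rw [← Finset.card_univ, Finset.card_eq_sum_card_fiberwise
    (f := fun g => g - R.rep g 3 • e 3) (t := R.base)]
  · refine Finset.sum_congr rfl fun f hf => ?_
    rw [← Finset.card_range (R.height f)]
    symm
    have hf0 := R.mem_base.mp hf
    refine Finset.card_bij (fun k _ => f + k • e 3) ?_ ?_ ?_
    · intro k hk
      simp [R.rep_add_of_lt (Finset.mem_range.mp hk), hf0]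
    · intro k hk l hl hkl
      have h := congrArg (fun g => R.rep g 3) hkl
      simpa [R.rep_add_of_lt (Finset.mem_range.mp hk),
        R.rep_add_of_lt (Finset.mem_range.mp hl)] using h
    · intro g hg
      have hg' : g - R.rep g 3 • e 3 = f := by simpa using hg
      refine ⟨R.rep g 3, ?_, by rw [← hg']; abel⟩
      rw [Finset.mem_range]
      by_contra hlt
      push Not at hlt
      apply R.rep_add_height f
      have h1 := R.rep_sub (g := g) (j := 3) (i := R.rep g 3 - R.height f) (Nat.sub_le _ _)
      have h2 := R.rep_sub (g := g) (j := 3) (i := R.rep g 3) le_rfl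
      rw [hg'] at h2
      have h3 : g - (R.rep g 3 - R.height f) • e 3 = f + R.height f • e 3 := by
        obtain ⟨m, hm⟩ := Nat.exists_eq_add_of_le hlt
        rw [hm, add_smul] at hg'
        rw [hm, Nat.add_sub_cancel_left, sub_eq_iff_eq_add.mp hg']
        abel
      rw [← h3, h1, h2]
      ext k
      rcases eq_or_ne k 3 with rfl | hk
      · simp only [Pi.add_apply, Pi.sub_apply, Pi.single_eq_same]
        omega
      · simp [hk]
  · intro g _
    have h2 := R.rep_sub (g := g) (j := 3) (i := R.rep g 3) le_rfl
    simp only [Finset.mem_coe, mem_base, h2]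
    simp

/-- The part of the simplex of size `d + 1` that the fibres miss is at least as large as the
overlap of the first coordinates at the two ends of the fibres. -/
theorem sum_min_le_sum_defect :
    ∑ f ∈ R.base, min (R.rep f 0) (R.rep (R.next f) 0) ≤
      ∑ f ∈ R.base, (d + 1 - ∑ i, R.rep f i - R.height f) := by
  classical
  have hl := Finset.card_sigma R.base
    (fun f => Finset.range (min (R.rep f 0) (R.rep (R.next f) 0)))
  have hr := Finset.card_sigma R.base
    (fun f => Finset.range (d + 1 - ∑ i, R.rep f i - R.height f))
  simp only [Finset.card_range] at hl hr
  rw [← hl, ← hr]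
  -- Passing from `f` to `f - (i + 1) • e 0` lowers the degree by `i + 1` without lengthening the
  -- fibre, so the defect there exceeds `i`. Keeping `i` makes the map injective.
  refine Finset.card_le_card_of_injOn (fun p => ⟨p.1 - (p.2 + 1) • e 0, p.2⟩) ?_ ?_
  · rintro ⟨f, i⟩ hp
    simp only [Finset.coe_sigma, Set.mem_sigma_iff, Finset.mem_coe, Finset.mem_range,
      lt_min_iff] at hp ⊢
    obtain ⟨hf, h1, h2⟩ := hp
    have hrep := R.rep_sub (g := f) (j := 0) (i := i + 1) h1
    have hh := R.height_sub_le h2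
    have hd := R.degree_add_height_le f
    refine ⟨?_, ?_⟩
    · rw [mem_base, hrep]
      simp [R.mem_base.mp hf]
    · rw [hrep]
      simp only [Fin.sum_univ_four] at hd ⊢
      simp only [Pi.sub_apply, Pi.single_eq_same]
      simp only [Pi.single_apply]
      simp only [show ((1 : Fin 4) = 0) = False by simp, show ((2 : Fin 4) = 0) = False by simp,
        show ((3 : Fin 4) = 0) = False by simp, if_false]
      rw [Nat.succ_eq_add_one] at hh
      omega
  · rintro ⟨f, i⟩ _ ⟨f', i'⟩ _ h
    simp only [Sigma.mk.injEq] at h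
    obtain ⟨h1, h2⟩ := h
    obtain rfl := eq_of_heq h2
    simpa using h1

theorem card_le_sum_base (t : ℕ) :
    Fintype.card G ≤ ∑ f ∈ R.base,
      (d + 1 + t - 2 * min (R.rep f 0) t - R.rep f 0 - R.rep f 1 - R.rep f 2) := by
  have h1 := R.sum_min_le_sum_defect
  have h2 := R.card_eq_sum_height
  have h3 := R.sum_next (fun g => min (R.rep g 0) t)
  have h4 : ∑ f ∈ R.base, (min (R.rep f 0) t + min (R.rep (R.next f) 0) t) ≤
      ∑ f ∈ R.base, (min (R.rep f 0) (R.rep (R.next f) 0) + t) :=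
    Finset.sum_le_sum fun f _ => by omega
  -- Height plus defect is exactly `d + 1` minus the degree; truncation can only enlarge the right
  -- side.
  have h5 : ∑ f ∈ R.base, (R.height f + (d + 1 - ∑ i, R.rep f i - R.height f) + t) ≤
      ∑ f ∈ R.base, ((d + 1 + t - 2 * min (R.rep f 0) t - R.rep f 0 - R.rep f 1 - R.rep f 2) +
        2 * min (R.rep f 0) t) := by
    refine Finset.sum_le_sum fun f hf => ?_
    have hd := R.degree_add_height_le f
    have h0 := R.mem_base.mp hf
    simp only [Fin.sum_univ_four] at hd ⊢
    omega
  simp only [Finset.sum_add_distrib, ← Finset.mul_sum] at h4 h5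
  omega

theorem card_le_sum_range (R : DownwardReps e d) (t : ℕ) :
    Fintype.card G ≤ ∑ x ∈ Finset.range (d + 1), ∑ y ∈ Finset.range (d + 1),
      ∑ z ∈ Finset.range (d + 1), (d + 1 + t - 2 * min x t - x - y - z) := by
  classical
  refine (R.card_le_sum_base t).trans ?_
  rw [← Finset.sum_product' , ← Finset.sum_product']
  have hinj : Set.InjOn (fun g => ((R.rep g 0, R.rep g 1), R.rep g 2)) R.base := by
    intro f hf f' hf' h
    simp only [Prod.mk.injEq] at h
    apply R.rep_injective
    have h0 := R.mem_base.mp hf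
    have h0' := R.mem_base.mp hf'
    ext k
    fin_cases k
    · exact h.1.1
    · exact h.1.2
    · exact h.2
    · exact h0.trans h0'.symm
  rw [← Finset.sum_image (f := fun p : (ℕ × ℕ) × ℕ =>
    d + 1 + t - 2 * min p.1.1 t - p.1.1 - p.1.2 - p.2) hinj]
  refine Finset.sum_le_sum_of_subset ?_
  refine Finset.image_subset_iff.mpr fun f _ => ?_
  have hd := R.degree_le f
  simp only [Fin.sum_univ_four] at hd
  simp only [Finset.mem_product, Finset.mem_range]
  omega

end DownwardReps

/-! ### Lattice point counts and the choice of `t` -/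

theorem sum_range_choose_tsub_le (r c M : ℕ) :
    ∑ y ∈ Finset.range M, (c + r - y).choose (r + 1) ≤ (c + r + 1).choose (r + 2) := by
  induction c generalizing M with
  | zero =>
    refine le_of_eq_of_le (Finset.sum_eq_zero fun y _ => ?_) (Nat.zero_le _)
    exact Nat.choose_eq_zero_of_lt (by omega)
  | succ c ih =>
    cases M with
    | zero => simp
    | succ M =>
      rw [Finset.sum_range_succ']
      have h : ∀ y, c + 1 + r - (y + 1) = c + r - y := fun y => by omega
      simp only [h, Nat.sub_zero]
      have := ih M
      have h2 : c + 1 + r + 1 = (c + r + 1) + 1 := by omega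
      have h3 : c + 1 + r = c + r + 1 := by omega
      have h4 := Nat.choose_succ_succ' (c + r + 1) (r + 1)
      rw [h2, h3]
      change _ ≤ (c + r + 1 + 1).choose (r + 1 + 1)
      change _ ≤ (c + r + 1).choose (r + 1 + 1) at this
      omega

theorem sum_range_sum_range_tsub_le (c M : ℕ) :
    ∑ y ∈ Finset.range M, ∑ z ∈ Finset.range M, (c - y - z) ≤ (c + 2).choose 3 := by
  refine le_trans (Finset.sum_le_sum fun y _ => ?_) (sum_range_choose_tsub_le 1 c M)
  refine le_trans (le_of_eq ?_) (le_trans (sum_range_choose_tsub_le 0 (c - y) M) ?_)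
  · simp
  · rcases le_total y c with h | h
    · rw [show c - y + 0 + 1 = c + 1 - y by omega]
    · rw [show c - y + 0 + 1 = 1 by omega]
      simp

theorem choose_three_le (c : ℕ) : ((c + 2).choose 3 : ℝ) ≤ ((c : ℝ) + 1) ^ 3 / 6 := by
  rw [Nat.cast_choose_eq_descPochhammer_div]
  simp [descPochhammer_succ_eval, Nat.factorial]
  have : (0 : ℝ) ≤ c := Nat.cast_nonneg c
  nlinarith

/-- The four consecutive factors have mean `c + 3 / 2`. -/
theorem choose_four_le (c : ℕ) :
    ((c + 3).choose 4 : ℝ) ≤ ((c : ℝ) + 3 / 2) ^ 4 / 24 := by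
  rw [Nat.cast_choose_eq_descPochhammer_div]
  simp [descPochhammer_succ_eval, Nat.factorial]
  have : (0 : ℝ) ≤ c := Nat.cast_nonneg c
  nlinarith [sq_nonneg ((c : ℝ) + 3 / 2)]

/-- Midpoint rule for the convex cube: each term is at most the integral over an interval of length
three centred at its node, and these integrals telescope. -/
theorem sum_range_cube_le (B : ℝ) (t : ℕ) (h : 3 * (t : ℝ) ≤ B + 3) :
    ∑ k ∈ Finset.range t, (B - 3 * k) ^ 3 ≤
      ((B + 3 / 2) ^ 4 - (B + 3 / 2 - 3 * t) ^ 4) / 12 := by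
  induction t with
  | zero => simp
  | succ t ih =>
    push_cast at h ⊢
    rw [Finset.sum_range_succ]
    have := ih (by linarith)
    have h2 : 0 ≤ B - 3 * (t : ℝ) := by linarith
    have h3 : (B + 3 / 2 - 3 * (t : ℝ)) ^ 4 - (B + 3 / 2 - 3 * ((t : ℝ) + 1)) ^ 4 =
        12 * (B - 3 * t) ^ 3 + 27 * (B - 3 * t) := by ring
    linarith

theorem sum_range_weighted_le_choose (d t M : ℕ) :
    ∑ x ∈ Finset.range M, ∑ y ∈ Finset.range M, ∑ z ∈ Finset.range M,
      (d + 1 + t - 2 * min x t - x - y - z) ≤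
      ∑ x ∈ Finset.range t, (d + 1 + t - 3 * x + 2).choose 3 +
        (d + 1 - 2 * t + 3).choose 4 := by
  calc _ ≤ ∑ x ∈ Finset.range M, (d + 1 + t - 2 * min x t - x + 2).choose 3 :=
        Finset.sum_le_sum fun x _ => sum_range_sum_range_tsub_le _ M
    _ ≤ ∑ x ∈ Finset.range (t + M), (d + 1 + t - 2 * min x t - x + 2).choose 3 :=
        Finset.sum_le_sum_of_subset (Finset.range_mono (by omega))
    _ = ∑ x ∈ Finset.range t, (d + 1 + t - 3 * x + 2).choose 3 +
        ∑ x ∈ Finset.range M, (d + 1 - 2 * t - x + 2).choose 3 := by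
      rw [Finset.sum_range_add]
      congr 1
      · refine Finset.sum_congr rfl fun x hx => ?_
        rw [Finset.mem_range] at hx
        congr 1
        omega
      · refine Finset.sum_congr rfl fun x hx => ?_
        congr 1
        omega
    _ ≤ _ := by
      refine Nat.add_le_add_left ?_ _
      refine le_trans (Finset.sum_le_sum fun x _ => ?_)
        (sum_range_choose_tsub_le 2 (d + 1 - 2 * t) M)
      rcases le_total x (d + 1 - 2 * t) with hx | hx
      · rw [show d + 1 - 2 * t - x + 2 = d + 1 - 2 * t + 2 - x by omega]
      · rw [show d + 1 - 2 * t - x + 2 = 2 by omega]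
        simp

/-- The lattice point count over a simplex in which the first coordinate is weighted by three up
to `t`, and by one beyond `t`. -/
theorem sum_range_weighted_le (d t M : ℕ) (h : 2 * t ≤ d + 1) (h3 : 3 * t ≤ d + 4) :
    ((∑ x ∈ Finset.range M, ∑ y ∈ Finset.range M, ∑ z ∈ Finset.range M,
      (d + 1 + t - 2 * min x t - x - y - z) : ℕ) : ℝ) ≤
      (((d : ℝ) + 4 + t) ^ 4 + 2 * ((d : ℝ) + 4 - 2 * t) ^ 4) / 72 := by
  refine (Nat.cast_le.mpr (sum_range_weighted_le_choose d t M)).trans ?_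
  push_cast
  have h2 : ∑ x ∈ Finset.range t, ((d + 1 + t - 3 * x + 2).choose 3 : ℝ) ≤
      ∑ x ∈ Finset.range t, (((d : ℝ) + 2 + t) - 3 * x) ^ 3 / 6 := by
    refine Finset.sum_le_sum fun x hx => ?_
    rw [Finset.mem_range] at hx
    refine (choose_three_le _).trans (le_of_eq ?_)
    rw [Nat.cast_sub (by omega)]
    push_cast
    ring
  rw [← Finset.sum_div] at h2
  have h3' : 3 * (t : ℝ) ≤ d + 4 := by exact_mod_cast h3
  have h4 := sum_range_cube_le ((d : ℝ) + 2 + t) t (by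
    have : (0 : ℝ) ≤ t := Nat.cast_nonneg t
    linarith)
  have h5 := choose_four_le (d + 1 - 2 * t)
  rw [Nat.cast_sub h] at h5
  push_cast at h5
  have h' : 2 * (t : ℝ) ≤ d + 1 := by exact_mod_cast h
  have h6 : ((d : ℝ) + 2 + t + 3 / 2) ^ 4 ≤ ((d : ℝ) + 4 + t) ^ 4 := by gcongr ?_ ^ 4; linarith
  have h7 : ((d : ℝ) + 1 - 2 * t + 3 / 2) ^ 4 ≤ ((d : ℝ) + 2 + t + 3 / 2 - 3 * t) ^ 4 :=
    pow_le_pow_left₀ (by linarith) (by linarith) 4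
  have h8 : ((d : ℝ) + 2 + t + 3 / 2 - 3 * t) ^ 4 ≤ ((d : ℝ) + 4 - 2 * t) ^ 4 :=
    pow_le_pow_left₀ (by linarith) (by linarith) 4
  linarith

theorem exists_threshold (d : ℕ) (hd : 17 ≤ d) : ∃ t : ℕ, 2 * t ≤ d + 1 ∧ 3 * t ≤ d + 4 ∧
    (((d : ℝ) + 4 + t) ^ 4 + 2 * ((d : ℝ) + 4 - 2 * t) ^ 4) / 72 ≤
      11 * ((d : ℝ) + 4) ^ 4 / 343 := by
  -- One seventh nearly minimises the left side, giving about `10.61 / 343`; the slack up to `11 /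
  -- 343` absorbs the rounding. From `17 ≤ d` the quotient is at least 3, so the remainder, at most
  -- 6, is at most twice it.
  refine ⟨(d + 4) / 7, by omega, by omega, ?_⟩
  obtain ⟨t, r, ht, hr, hdt⟩ : ∃ t r : ℕ, (d + 4) / 7 = t ∧ r ≤ 2 * t ∧ d + 4 = 7 * t + r :=
    ⟨(d + 4) / 7, (d + 4) % 7, rfl, by omega, by omega⟩
  have h1 : (d : ℝ) + 4 = 7 * t + r := by exact_mod_cast hdt
  have hr' : (r : ℝ) ≤ 2 * t := by exact_mod_cast hr
  have hr0 : (0 : ℝ) ≤ r := Nat.cast_nonneg r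
  have ht0 : (0 : ℝ) ≤ t := Nat.cast_nonneg t
  rw [ht, h1]
  generalize (r : ℝ) = r at *
  generalize (t : ℝ) = t at *
  have e2 : r ^ 2 ≤ (2 * t) ^ 2 := pow_le_pow_left₀ hr0 hr' 2
  have e3 : r ^ 3 ≤ (2 * t) ^ 3 := pow_le_pow_left₀ hr0 hr' 3
  have e4 : r ^ 4 ≤ (2 * t) ^ 4 := pow_le_pow_left₀ hr0 hr' 4
  have f2 := mul_le_mul_of_nonneg_left e2 (sq_nonneg t)
  have f3 := mul_le_mul_of_nonneg_left e3 ht0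
  have f1 : 0 ≤ t ^ 3 * r := by positivity
  have g4 : 0 ≤ t ^ 4 := by positivity
  ring_nf at *
  linarith

theorem choose_four_le_of_lt (d : ℕ) (hd : d < 17) :
    ((d + 4).choose 4 : ℝ) ≤ 11 * ((d : ℝ) + 4) ^ 4 / 343 := by
  refine (choose_four_le (d + 1)).trans ?_
  have : (d : ℝ) ≤ 16 := by exact_mod_cast (by omega : d ≤ 16)
  have h0 : (0 : ℝ) ≤ d := Nat.cast_nonneg d
  -- The ratio of the bases increases with `d` and equals `37 / 40` at `d = 16`.
  have h1 : ((d : ℝ) + 5 / 2) ^ 4 ≤ (37 / 40 * ((d : ℝ) + 4)) ^ 4 :=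
    pow_le_pow_left₀ (by linarith) (by linarith) 4
  push_cast
  have h2 : 0 ≤ ((d : ℝ) + 4) ^ 4 := by positivity
  rw [mul_pow] at h1
  rw [show (d : ℝ) + 1 + 3 / 2 = d + 5 / 2 by ring]
  linarith

theorem card_le_of_forall_exists {G : Type*} [AddCommGroup G] [Finite G] (e : Fin 4 → G) (d : ℕ)
    (h : ∀ g : G, ∃ x : Fin 4 → ℕ, ∑ i, x i ≤ d ∧ ∑ i, x i • e i = g) :
    (Nat.card G : ℝ) ≤ 11 * ((d : ℝ) + 4) ^ 4 / 343 := by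
  have := Fintype.ofFinite G
  obtain ⟨R⟩ := exists_downwardReps e d h
  rw [Nat.card_eq_fintype_card]
  rcases lt_or_ge d 17 with hd | hd
  · refine le_trans ?_ (choose_four_le_of_lt d hd)
    -- With `t = 0` this is the plain simplex count, which suffices for small `d`.
    have h0 := (R.card_le_sum_range 0).trans (sum_range_weighted_le_choose d 0 (d + 1))
    rw [Finset.sum_range_zero, zero_add, mul_zero, Nat.sub_zero] at h0
    exact_mod_cast h0
  · obtain ⟨t, h1, h2, h3⟩ := exists_threshold d hd
    exact ((Nat.cast_le.mpr (R.card_le_sum_range t)).trans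
      (sum_range_weighted_le d t (d + 1) h1 h2)).trans h3

/-! ### From digraphs to representations -/

theorem HasWalk.exists_coeff {G : Type*} [AddCommGroup G] {E : Set G} {e : Fin 4 → G}
    (he : E ⊆ Set.range e) {k : ℕ} {u v : G} (h : HasWalk (cayleyDigraph E) k u v) :
    ∃ x : Fin 4 → ℕ, ∑ i, x i = k ∧ u + ∑ i, x i • e i = v := by
  induction k generalizing u with
  | zero => exact ⟨0, by simp, by rw [show u = v from h]; simp⟩
  | succ k ih =>
    obtain ⟨w, ⟨g, hg, rfl⟩, hw⟩ := h
    obtain ⟨x, hx, hxv⟩ := ih hw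
    obtain ⟨i, rfl⟩ := he hg
    refine ⟨x + Pi.single i 1, ?_, ?_⟩
    · simp [Finset.sum_add_distrib, hx]
    · have h1 : ∑ j, (Pi.single i 1 : Fin 4 → ℕ) j • e j = e i := by
        rw [Finset.sum_eq_single i]
        · simp
        · intro j _ hj
          simp [hj]
        · simp
      simp only [Pi.add_apply, add_smul, Finset.sum_add_distrib, h1]
      rw [← hxv]
      abel

theorem exists_hasWalk_of_diameter_le {V : Type*} {Γ : Digraph V} {d : ℕ}
    (h : diameter Γ ≤ (d : ℕ∞)) (u v : V) : ∃ k ≤ d, HasWalk Γ k u v := by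
  have h1 : ddist Γ u v < ((d + 1 : ℕ) : ℕ∞) :=
    lt_of_le_of_lt ((le_iSup₂ (f := fun u v => ddist Γ u v) u v).trans h)
      (by exact_mod_cast Nat.lt_succ_self d)
  unfold ddist at h1
  simp only [iInf_lt_iff] at h1
  obtain ⟨k, hk, hlt⟩ := h1
  exact ⟨k, Nat.lt_succ_iff.mp (by exact_mod_cast hlt), hk⟩

/-- Pads a smaller generating set to exactly `n` generators by repetition. -/
theorem exists_range_superset {α : Type*} [Nonempty α] {E : Set α} (hE : E.Finite)
    {n : ℕ} (h : E.ncard ≤ n) : ∃ e : Fin n → α, E ⊆ Set.range e := by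
  classical
  have := hE.fintype
  rcases E.eq_empty_or_nonempty with rfl | ⟨a, ha⟩
  · exact ⟨fun _ => Classical.arbitrary α, Set.empty_subset _⟩
  · have hc : Fintype.card E ≤ Fintype.card (Fin n) := by
      rwa [Fintype.card_fin, ← Nat.card_eq_fintype_card, Nat.card_coe_set_eq]
    obtain ⟨φ⟩ := Function.Embedding.nonempty_of_card_le hc
    have : Nonempty E := ⟨⟨a, ha⟩⟩
    refine ⟨fun i => (Function.invFun φ i : E), fun b hb => ⟨φ ⟨b, hb⟩, ?_⟩⟩
    simp [Function.leftInverse_invFun φ.injective ⟨b, hb⟩]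

theorem card_le_of_diameter_le {G : Type*} [AddCommGroup G] [Finite G] {E : Set G} {d : ℕ}
    (hE : E.ncard ≤ 4) (hd : diameter (cayleyDigraph E) ≤ (d : ℕ∞)) :
    (Nat.card G : ℝ) ≤ 11 * ((d : ℝ) + 4) ^ 4 / 343 := by
  obtain ⟨e, he⟩ := exists_range_superset E.toFinite hE
  refine card_le_of_forall_exists e d fun g => ?_
  obtain ⟨k, hk, hw⟩ := exists_hasWalk_of_diameter_le hd 0 g
  obtain ⟨x, hx, hxg⟩ := hw.exists_coeff he
  exact ⟨x, hx.trans_le hk, by simpa using hxg⟩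

theorem cayleyOrders_four_nonempty {d : ℕ} (hd : 0 < d) : (cayleyOrders 4 d).Nonempty := by
  -- The nonzero elements of `ZMod 5` give the complete digraph on five vertices, of diameter one.
  refine ⟨Nat.card (ZMod 5), ZMod 5, inferInstance, inferInstance, {0}ᶜ, ?_, ?_, ?_, rfl⟩
  · refine eq_top_iff.mpr fun g _ => ?_
    by_cases hg : g = 0
    · rw [hg]
      exact zero_mem _
    · exact AddSubgroup.subset_closure hg
  · rw [Set.ncard_compl, Set.ncard_singleton, Nat.card_zmod]
  · refine iSup₂_le fun u v => ?_
    unfold ddist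
    by_cases h : u = v
    · exact (iInf₂_le 0 h).trans (by simp)
    · refine (iInf₂_le 1 ⟨v, ⟨v - u, sub_ne_zero.mpr (Ne.symm h), by abel⟩, rfl⟩).trans ?_
      exact_mod_cast hd

end AbelianCayley

theorem theorem1p3 (d : ℕ) :
    (∀ (G : Type*) [AddCommGroup G] [Finite G] (E : Set G),
      AddSubgroup.closure E = ⊤ →
      (∀ u : G, AbelianCayley.outDegree (AbelianCayley.cayleyDigraph E) u ≤ 4) →
      AbelianCayley.diameter (AbelianCayley.cayleyDigraph E) ≤ (d : ℕ∞) →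
        (Nat.card G : ℝ) ≤ 11 * ((d : ℝ) + 4) ^ 4 / 343) ∧
    (0 < d →
      IsGreatest (AbelianCayley.cayleyOrders 4 d) (AbelianCayley.f 4 d) ∧
        (AbelianCayley.f 4 d : ℝ) ≤ 11 * ((d : ℝ) + 4) ^ 4 / 343) := by
  have bound : ∀ m ∈ AbelianCayley.cayleyOrders 4 d, (m : ℝ) ≤ 11 * ((d : ℝ) + 4) ^ 4 / 343 := by
    rintro m ⟨G, _, _, E, -, hE, hdiam, rfl⟩
    exact AbelianCayley.card_le_of_diameter_le hE.le hdiam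
  refine ⟨fun G _ _ E _ hdeg hdiam => ?_, fun hd => ?_⟩
  · have hE := hdeg 0
    rw [AbelianCayley.outDegree_cayleyDigraph] at hE
    exact AbelianCayley.card_le_of_diameter_le hE hdiam
  · have hbdd : BddAbove (AbelianCayley.cayleyOrders 4 d) :=
      ⟨⌊11 * ((d : ℝ) + 4) ^ 4 / 343⌋₊, fun m hm => Nat.le_floor (bound m hm)⟩
    have hmem := Nat.sSup_mem (AbelianCayley.cayleyOrders_four_nonempty hd) hbdd
    exact ⟨⟨hmem, fun m hm => le_csSup hbdd hm⟩, bound _ hmem⟩
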